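/- Let $d\ge 1$, let $T^d=\{x\in\mathbb R^d: x_1,\dots,x_d\ge 0,\ x_1+\cdots+x_d\le 1\}$, and equip $L_2(T^d)$ with $\langle f,g\rangle=d!\int_{T^d}fg\,dx$. For $\ell\ge 0$ let $\mathcal V_\ell^d$ be the space of polynomials of degree at most $\ell$ that are orthogonal to all polynomials of degree less than $\ell$, let $\{P_{\ell,k}\}_{1\le k\le r_\ell^d}$ be an orthonormal basis of $\mathcal V_\ell^d$, where $r_\ell^d=\dim\mathcal V_\ell^d$, and put $P_\ell(x,y)=\sum_k P_{\ell,k}(x)P_{\ell,k}(y)$. For $r>0$ and $\gamma>0$ let $H_{1,\gamma}\subseteq L_2(T^d)$ be the closure of the polynomials with respect to the norm $$\|f\|_1^2=\Big(d!\int_{T^d}f\,dx\Big)^2+\frac1\gamma\sum_{\ell\ge1}\sum_k[\ell(\ell+d)]^r\langle f,P_{\ell,k}\rangle^2 .$$ For $m\in\mathbb N$ and positive weights $\gamma_m=(\gamma_{m,1},\dots,\gamma_{m,m})$ let $H_m=H_{1,\gamma_{m,1}}\otimes\cdots\otimes H_{1,\gamma_{m,m}}\subseteq L_2((T^d)^m)$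 be the Hilbert space tensor product, whose norm is $$\|f\|_m^2=\sum_{\ell\in\mathbb N_0^m}\sum_{k}\Big(\prod_{j=1}^m B_j(\ell_j)\Big)a_k^\ell(f)^2,\qquad a_k^\ell(f)=(d!)^m\int_{(T^d)^m}f(x)\prod_{j=1}^mP_{\ell_j,k_j}(x_j)\,dx,$$ where $B_j(0)=1$ and $B_j(\ell)=\gamma_{m,j}^{-1}[\ell(\ell+d)]^r$ for $\ell\ge1$. For $t_1,\dots,t_n\in(T^d)^m$ the worst-case error is $$e_{n,m}(t_1,\dots,t_n)=\sup_{f\in H_m,\ \|f\|_m\le1}\Big|(d!)^m\int_{(T^d)^m}f\,dx-\frac1n\sum_{i=1}^nf(t_i)\Big|,$$ where the elements of $H_m$ are evaluated at points through their continuous representatives (these exist when $r>d+1$). There is a constant $M$ depending only on $d$ such that $P_\ell(x,y)\le M\ell^{2d}$ for all $\ell\ge1$ and $x,y\in T^d$. For every such $M$, every $r>d+1$, every $m$, all positive weights $\gamma_{m,1},\dots,\gamma_{m,m}$ and every $n\ge1$, there exist points $t_1,\dots,t_n\in(T^d)^m$ such that $$e_{n,m}^2(t_1,\dots,t_n)\le\frac1n\Big(\prod_{j=1}^m(1+\gamma_{m,j}c_{d,r})-1\Big),\qquad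 c_{d,r}:=M\sum_{\ell=1}^\infty\frac{\ell^{2d}}{[\ell(\ell+d)]^r};$$ equivalently, $e_{n,m}(t_1,\dots,t_n)\le\big(\prod_{j=1}^m(1+\gamma_{m,j}c_{d,r})-1\big)^{1/2}n^{-1/2}$. -/

import Mathlib

open MeasureTheory
open scoped ENNReal Nat

namespace SimplexQMC

/-- The simplex `T^d = {x ∈ ℝ^d : x_i ≥ 0, 1 - ∑ x_i ≥ 0}`. -/
def simplex (d : ℕ) : Set (Fin d → ℝ) :=
  {x | (∀ i, 0 ≤ x i) ∧ 0 ≤ 1 - ∑ i, x i}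

/-- The measure `d! dx` on `T^d`. -/
noncomputable def simplexMeasure (d : ℕ) : Measure (simplex d) :=
  (d ! : ℝ≥0∞) • Measure.comap Subtype.val (volume : Measure (Fin d → ℝ))

/-- The measure `(d!)^m dx` on `(T^d)^m`. -/
noncomputable def prodMeasure (d m : ℕ) : Measure (Fin m → simplex d) :=
  Measure.pi fun _ => simplexMeasure d

theorem isClosed_simplex (d : ℕ) : IsClosed (simplex d) := by
  have h : simplex d = (⋂ i, {x : Fin d → ℝ | 0 ≤ x i}) ∩ {x | 0 ≤ 1 - ∑ i, x i} := by
    ext x; simp [simplex]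
  rw [h]
  refine IsClosed.inter (isClosed_iInter fun i => ?_) ?_
  · exact isClosed_le continuous_const (continuous_apply i)
  · exact isClosed_le continuous_const (by fun_prop)

theorem isCompact_simplex (d : ℕ) : IsCompact (simplex d) := by
  refine IsCompact.of_isClosed_subset (isCompact_Icc (a := (0 : Fin d → ℝ)) (b := 1))
    (isClosed_simplex d) ?_
  rintro x ⟨h0, h1⟩
  refine ⟨fun i => h0 i, fun i => ?_⟩
  have := Finset.single_le_sum (f := x) (fun i _ => h0 i) (Finset.mem_univ i)
  simp only [Pi.one_apply]
  linarith

instance (d : ℕ) : CompactSpace (simplex d) :=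
  isCompact_iff_compactSpace.mp (isCompact_simplex d)

instance (d : ℕ) : IsFiniteMeasure (simplexMeasure d) := by
  refine ⟨?_⟩
  rw [simplexMeasure, Measure.smul_apply, comap_subtype_coe_apply
    (isClosed_simplex d).measurableSet]
  simp only [Set.image_univ, Subtype.range_coe_subtype, Set.ofPred_mem_eq, smul_eq_mul]
  exact ENNReal.mul_lt_top (by simp) (isCompact_simplex d).measure_lt_top

theorem continuous_polyEval {d : ℕ} (p : MvPolynomial (Fin d) ℝ) :
    Continuous fun x : simplex d => MvPolynomial.eval x.1 p :=
  (MvPolynomial.continuous_eval p).comp continuous_subtype_val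

theorem integrable_polyEval_mul {d : ℕ} (p q : MvPolynomial (Fin d) ℝ) :
    Integrable (fun x : simplex d => MvPolynomial.eval x.1 p * MvPolynomial.eval x.1 q)
      (simplexMeasure d) :=
  ((continuous_polyEval p).mul (continuous_polyEval q)).integrable_of_hasCompactSupport
    (HasCompactSupport.of_compactSpace _)

/-- `⟨p, q⟩ = d! ∫_{T^d} p q dx` on polynomials, as a bilinear form. -/
noncomputable def polyInner (d : ℕ) : LinearMap.BilinForm ℝ (MvPolynomial (Fin d) ℝ) :=
  LinearMap.mk₂ ℝ
    (fun p q => ∫ x, MvPolynomial.eval x.1 p * MvPolynomial.eval x.1 q ∂simplexMeasure d)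
    (fun p p' q => by
      rw [← integral_add (integrable_polyEval_mul _ _) (integrable_polyEval_mul _ _)]
      simp [add_mul])
    (fun c p q => by
      rw [smul_eq_mul, ← integral_const_mul]
      simp [mul_assoc])
    (fun p q q' => by
      rw [← integral_add (integrable_polyEval_mul _ _) (integrable_polyEval_mul _ _)]
      simp [mul_add])
    (fun c p q => by
      rw [smul_eq_mul, ← integral_const_mul]
      simp [mul_left_comm])

theorem polyInner_apply (d : ℕ) (p q : MvPolynomial (Fin d) ℝ) : polyInner d p q =
    ∫ x, MvPolynomial.eval x.1 p * MvPolynomial.eval x.1 q ∂simplexMeasure d := rfl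

theorem polyInner_self_pos {d : ℕ} {p : MvPolynomial (Fin d) ℝ} (hp : p ≠ 0) :
    0 < polyInner d p p := by
  have hnn : 0 ≤ polyInner d p p := integral_nonneg fun x => mul_self_nonneg _
  refine lt_of_le_of_ne hnn fun h0 => hp ?_
  rw [polyInner_apply, eq_comm, integral_eq_zero_iff_of_nonneg (fun x => mul_self_nonneg _)
    (integrable_polyEval_mul _ _)] at h0
  set O : Set (Fin d → ℝ) := Set.univ.pi fun _ => Set.Ioo (0 : ℝ) (1 / (d + 1)) with hO
  have hOo : IsOpen O := isOpen_set_pi Set.finite_univ fun _ _ => isOpen_Ioo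
  have hOT : O ⊆ simplex d := by
    intro x hx
    simp only [hO, Set.mem_univ_pi, Set.mem_Ioo] at hx
    refine ⟨fun i => (hx i).1.le, ?_⟩
    have h1 : ∑ i, x i ≤ ∑ _i : Fin d, (1 : ℝ) / (d + 1) :=
      Finset.sum_le_sum fun i _ => (hx i).2.le
    have h2 : ∑ _i : Fin d, (1 : ℝ) / (d + 1) ≤ 1 := by
      rw [Finset.sum_const, Finset.card_univ, Fintype.card_fin, nsmul_eq_mul, mul_one_div,
        div_le_one (by positivity)]
      linarith
    linarith
  have hae : ∀ᵐ x ∂(volume.restrict (simplex d) : Measure (Fin d → ℝ)),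
      MvPolynomial.eval x p = 0 := by
    rw [ae_restrict_iff_subtype (isClosed_simplex d).measurableSet]
    have h1 : (d ! : ℝ≥0∞) ≠ 0 := by exact_mod_cast Nat.factorial_ne_zero d
    have h2 := h0
    rw [simplexMeasure, Filter.EventuallyEq, Measure.ae_ennreal_smul_measure_iff h1] at h2
    filter_upwards [h2] with x hx
    simpa using hx
  have hae2 : (fun x => MvPolynomial.eval x p) =ᵐ[volume.restrict O] fun _ => (0 : ℝ) :=
    ae_mono (Measure.restrict_mono hOT le_rfl) hae
  have hz := Measure.eqOn_open_of_ae_eq hae2 hOo (MvPolynomial.continuous_eval p).continuousOn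
    continuousOn_const
  refine MvPolynomial.funext_set (fun _ => Set.Ioo (0 : ℝ) (1 / (d + 1)))
    (fun _ => Set.Ioo_infinite (by positivity)) fun x hx => ?_
  simpa using hz hx

/-- `V_ℓ^d`: the polynomials of degree at most `ℓ` on `T^d` that are orthogonal to all polynomials
of degree less than `ℓ`. -/
noncomputable def orthoPoly (d ℓ : ℕ) : Submodule ℝ (MvPolynomial (Fin d) ℝ) where
  carrier := {p | p.totalDegree ≤ ℓ ∧ ∀ q, q.totalDegree < ℓ → polyInner d p q = 0}
  zero_mem' := by simp
  add_mem' := by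
    rintro p q ⟨hp, hp'⟩ ⟨hq, hq'⟩
    exact ⟨(MvPolynomial.totalDegree_add p q).trans (max_le hp hq),
      fun s hs => by simp [hp' s hs, hq' s hs]⟩
  smul_mem' := by
    rintro c p ⟨hp, hp'⟩
    exact ⟨(MvPolynomial.totalDegree_smul_le c p).trans hp, fun s hs => by simp [hp' s hs]⟩

instance (d ℓ : ℕ) : FiniteDimensional ℝ (orthoPoly d ℓ) := by
  have h : orthoPoly d ℓ ≤ MvPolynomial.restrictTotalDegree (Fin d) ℝ ℓ := fun p hp =>
    (MvPolynomial.mem_restrictTotalDegree _ _ _).mpr hp.1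
  have : FiniteDimensional ℝ (MvPolynomial.restrictTotalDegree (Fin d) ℝ ℓ) := by
    infer_instance
  exact Submodule.finiteDimensional_of_le h

/-- `r_ℓ^d = dim V_ℓ^d`. -/
noncomputable def orthoDim (d ℓ : ℕ) : ℕ := Module.finrank ℝ (orthoPoly d ℓ)

theorem exists_orthonormal_basis (d ℓ : ℕ) :
    ∃ P : Fin (orthoDim d ℓ) → MvPolynomial (Fin d) ℝ,
      (∀ j k, polyInner d (P j) (P k) = if j = k then 1 else 0) ∧
      Submodule.span ℝ (Set.range P) = orthoPoly d ℓ := by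
  unfold orthoDim
  have hsymm : LinearMap.IsSymm ((polyInner d).restrict (orthoPoly d ℓ)) := by
    refine ⟨fun p q => ?_⟩
    simp [polyInner_apply, mul_comm]
  obtain ⟨v, hv⟩ := LinearMap.BilinForm.exists_orthogonal_basis hsymm
  have hpos : ∀ k, 0 < polyInner d (v k) (v k) := fun k =>
    polyInner_self_pos fun h => v.ne_zero k (Subtype.ext h)
  have hne : ∀ k, (Real.sqrt (polyInner d (v k) (v k)))⁻¹ ≠ 0 := fun k =>
    inv_ne_zero (Real.sqrt_pos.mpr (hpos k)).ne'
  let w := v.isUnitSMul (w := fun k => (Real.sqrt (polyInner d (v k) (v k)))⁻¹)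
    fun k => (hne k).isUnit
  have hw : ∀ k, ((w k : orthoPoly d ℓ) : MvPolynomial (Fin d) ℝ) =
      (Real.sqrt (polyInner d (v k) (v k)))⁻¹ • (v k : MvPolynomial (Fin d) ℝ) := fun k => by
    simp [w, Module.Basis.isUnitSMul_apply]
  refine ⟨fun k => (w k : MvPolynomial (Fin d) ℝ), fun j k => ?_, ?_⟩
  · simp only [hw, map_smul, LinearMap.smul_apply, smul_eq_mul]
    split_ifs with hjk
    · subst hjk
      have h1 := Real.mul_self_sqrt (hpos j).le
      have h2 := (Real.sqrt_pos.mpr (hpos j)).ne'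
      field_simp
      nlinarith
    · have : polyInner d (v j) (v k) = 0 := hv hjk
      simp [this]
  · have h3 : Set.range (fun k => (w k : MvPolynomial (Fin d) ℝ)) =
        (orthoPoly d ℓ).subtype '' Set.range w := by
      rw [← Set.range_comp]; rfl
    change Submodule.span ℝ (Set.range fun k => (w k : MvPolynomial (Fin d) ℝ)) = _
    rw [h3, Submodule.span_image, w.span_eq, Submodule.map_top, Submodule.range_subtype]

/-- A fixed orthonormal basis `P_{ℓ,k}` of `V_ℓ^d`. -/
noncomputable def P (d ℓ : ℕ) : Fin (orthoDim d ℓ) → MvPolynomial (Fin d) ℝ :=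
  (exists_orthonormal_basis d ℓ).choose

theorem P_orthonormal (d ℓ : ℕ) (j k : Fin (orthoDim d ℓ)) :
    polyInner d (P d ℓ j) (P d ℓ k) = if j = k then 1 else 0 :=
  (exists_orthonormal_basis d ℓ).choose_spec.1 j k

theorem span_P (d ℓ : ℕ) : Submodule.span ℝ (Set.range (P d ℓ)) = orthoPoly d ℓ :=
  (exists_orthonormal_basis d ℓ).choose_spec.2

/-- `P_ℓ(x, y) = ∑_k P_{ℓ,k}(x) P_{ℓ,k}(y)`. -/
noncomputable def kernelP (d ℓ : ℕ) (x y : simplex d) : ℝ :=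
  ∑ k, MvPolynomial.eval x.1 (P d ℓ k) * MvPolynomial.eval y.1 (P d ℓ k)

/-- `M` satisfies `P_ℓ(x, y) ≤ M ℓ^{2d}` for all `ℓ ≥ 1` and `x, y ∈ T^d`. -/
def IsKernelBound (d : ℕ) (M : ℝ) : Prop :=
  ∀ ℓ : ℕ, 1 ≤ ℓ → ∀ x y : simplex d, kernelP d ℓ x y ≤ M * (ℓ : ℝ) ^ (2 * d)

/-- `c_{d,r} = M ∑_{ℓ ≥ 1} ℓ^{2d} / [ℓ(ℓ+d)]^r`; the summation index below is `ℓ - 1`. -/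
noncomputable def cConst (d : ℕ) (r M : ℝ) : ℝ :=
  M * ∑' i : ℕ, ((i + 1 : ℕ) : ℝ) ^ (2 * d) / (((i + 1 : ℕ) : ℝ) * ((i + 1 : ℕ) + d)) ^ r

/-- The Fourier coefficient `a_k^ℓ(u) = d! ∫_{T^d} u P_{ℓ,k} dx`. -/
noncomputable def coeff1 {d : ℕ} (ℓ : ℕ) (k : Fin (orthoDim d ℓ))
    (u : Lp ℝ 2 (simplexMeasure d)) : ℝ :=
  ∫ x, u x * MvPolynomial.eval x.1 (P d ℓ k) ∂simplexMeasure d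

/-- `‖u‖_1² = I_1(u)² + γ⁻¹ ‖(-∇)^{r/2} u‖²` in `[0, ∞]`, where `(-∇)^{r/2}` multiplies the
coefficient `a_k^ℓ` by `[ℓ(ℓ+d)]^{r/2}`, so that the squared `L₂` norm of `(-∇)^{r/2} u` is the
sum of the `[ℓ(ℓ+d)]^r a_k^ℓ(u)²`. -/
noncomputable def normSq1 {d : ℕ} (r γ : ℝ) (u : Lp ℝ 2 (simplexMeasure d)) : ℝ≥0∞ :=
  ENNReal.ofReal ((∫ x, u x ∂simplexMeasure d) ^ 2) +
    ENNReal.ofReal (1 / γ) *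
      ∑' ℓ : ℕ, ∑ k, ENNReal.ofReal (((ℓ : ℝ) * (ℓ + d)) ^ r * coeff1 ℓ k u ^ 2)

/-- The Sobolev space `H_{1,γ}^{(d,r)} ⊆ L₂(T^d)`: the closure of the polynomials with respect to
`‖·‖_1`. -/
def H1 (d : ℕ) (r γ : ℝ) : Set (Lp ℝ 2 (simplexMeasure d)) :=
  {u | ∀ ε : ℝ≥0∞, 0 < ε → ∃ (p : MvPolynomial (Fin d) ℝ) (v : Lp ℝ 2 (simplexMeasure d)),
    (v =ᵐ[simplexMeasure d] fun x => MvPolynomial.eval x.1 p) ∧ normSq1 r γ (u - v) < ε}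

/-- `B_{d,r,γ}(ℓ)`: `1` if `ℓ = 0` and `[ℓ(ℓ+d)]^r / γ` if `ℓ ≥ 1`. -/
noncomputable def B (d : ℕ) (r γ : ℝ) (ℓ : ℕ) : ℝ :=
  if ℓ = 0 then 1 else 1 / γ * ((ℓ : ℝ) * (ℓ + d)) ^ r

/-- The Fourier coefficient `(d!)^m ∫_{(T^d)^m} u(x) ∏_j P_{ℓ_j,k_j}(x_j) dx`. -/
noncomputable def coeff {d m : ℕ} (ℓ : Fin m → ℕ) (k : ∀ j, Fin (orthoDim d (ℓ j)))
    (u : Lp ℝ 2 (prodMeasure d m)) : ℝ :=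
  ∫ x, u x * ∏ j, MvPolynomial.eval (x j).1 (P d (ℓ j) (k j)) ∂prodMeasure d m

/-- `‖u‖_m² = ∑_ℓ ∑_k (∏_j B_{d,r,γ_j}(ℓ_j)) a_k^ℓ(u)²` in `[0, ∞]`. -/
noncomputable def normSq {d m : ℕ} (r : ℝ) (γ : Fin m → ℝ)
    (u : Lp ℝ 2 (prodMeasure d m)) : ℝ≥0∞ :=
  ∑' ℓ : Fin m → ℕ, ∑ k : ∀ j, Fin (orthoDim d (ℓ j)),
    ENNReal.ofReal ((∏ j, B d r (γ j) (ℓ j)) * coeff ℓ k u ^ 2)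

/-- The algebraic tensor product of the `H_{1,γ_j}`: the span of the functions
`x ↦ ∏_j f_j(x_j)` with `f_j ∈ H_{1,γ_j}`. -/
noncomputable def algTensor (d : ℕ) {m : ℕ} (r : ℝ) (γ : Fin m → ℝ) :
    Submodule ℝ (Lp ℝ 2 (prodMeasure d m)) :=
  Submodule.span ℝ {u | ∃ f : Fin m → Lp ℝ 2 (simplexMeasure d),
    (∀ j, f j ∈ H1 d r (γ j)) ∧ u =ᵐ[prodMeasure d m] fun x => ∏ j, f j (x j)}

/-- `H_m = H_{1,γ_1} ⊗ ⋯ ⊗ H_{1,γ_m} ⊆ L₂((T^d)^m)`: the closure of the algebraic tensor product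
with respect to `‖·‖_m`. -/
def H (d : ℕ) {m : ℕ} (r : ℝ) (γ : Fin m → ℝ) : Set (Lp ℝ 2 (prodMeasure d m)) :=
  {u | ∀ ε : ℝ≥0∞, 0 < ε → ∃ v ∈ algTensor d r γ, normSq r γ (u - v) < ε}

/-- `I_m(f) = (d!)^m ∫_{(T^d)^m} f dx`. -/
noncomputable def I {d m : ℕ} (f : (Fin m → simplex d) → ℝ) : ℝ :=
  ∫ x, f x ∂prodMeasure d m

/-- `Q_{n,m}(f) = (1/n) ∑_i f(t_i)`. -/
noncomputable def Q {d m n : ℕ} (t : Fin n → Fin m → simplex d)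
    (f : (Fin m → simplex d) → ℝ) : ℝ :=
  1 / (n : ℝ) * ∑ i, f (t i)

/-- The worst-case error `e_{n,m}(t_1, …, t_n)`, the supremum of `|I_m(f) - Q_{n,m}(f)|` over the
unit ball of `H_m`. A class `u ∈ H_m ⊆ L₂` is evaluated at points through its continuous
representative `f`, which is unique if it exists; a class without one would contribute
`⊤` (the infimum over the empty set). -/
noncomputable def worstCaseError {d m n : ℕ} (r : ℝ) (γ : Fin m → ℝ)
    (t : Fin n → Fin m → simplex d) : ℝ≥0∞ :=
  ⨆ (u : Lp ℝ 2 (prodMeasure d m)) (_ : u ∈ H d r γ) (_ : normSq r γ u ≤ 1),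
    ⨅ (f : C(Fin m → simplex d, ℝ)) (_ : u =ᵐ[prodMeasure d m] f),
      ENNReal.ofReal |I f - Q t f|

end SimplexQMC

/-! The proof is a Monte Carlo average. With `d! dx` a probability measure on `T^d`, let `T` be the
error functional, `ψ` the product polynomials `prodP ℓ k` and `W = ∏ B(ℓ_j)`. Cauchy–Schwarz in the
Fourier series bounds the squared worst-case error by the sum of `T(ψ)^2 / W` over all `ℓ` and `k`
(`worstCaseError_le`). For independent random points the mean of `T(ψ)^2` is `Var ψ / n`
(`lintegral_sq_error`), and some point set does no worse than the mean
(`exists_points_tsum_sq_error_le`).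

For fixed `ℓ` the variances add up to at most the supremum of the diagonal kernel `∏ P_{ℓ_j}(x_j,
x_j)`. Divided by `W`, this is at most a product of one-variable bounds whose sum over `ℓ` factors
into `∏ (1 + γ_j c_{d,r})`. At `ℓ = 0` the functions are constant and have no variance, which
removes the term 1.

Two analytic facts support this. The kernel bound comes from comparing sup and `L₂` norms: by a
Markov inequality a polynomial of degree `ℓ` stays above half its maximum on a copy of `T^d` shrunk
by a factor of order `ℓ^{-2}` (`sq_eval_le_polyInner`). Point evaluation is legitimate because
finite norm makes the Fourier series converge uniformly, and by Stone–Weierstrass its sum represents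
the given class (`ae_eq_tsum_coeff`). -/

namespace SimplexQMC

/-! ### The volume of the simplex -/

open scoped Pointwise in
theorem smul_simplex {d : ℕ} {t : ℝ} (ht : 0 < t) :
    t • simplex d = {x | (∀ i, 0 ≤ x i) ∧ ∑ i, x i ≤ t} := by
  ext x
  rw [Set.mem_smul_set_iff_inv_smul_mem₀ ht.ne']
  simp only [simplex, Set.mem_ofPred_eq, Pi.smul_apply, smul_eq_mul, ← Finset.mul_sum, sub_nonneg]
  refine and_congr (forall_congr' fun i => ?_) ?_
  · rw [mul_nonneg_iff_of_pos_left (inv_pos.mpr ht)]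
  · rw [inv_mul_le_iff₀ ht, mul_one]

open scoped Pointwise in
theorem volume_simplex_slice {d : ℕ} {s : ℝ} (h1 : s < 1) :
    volume {y : Fin d → ℝ | (∀ i, 0 ≤ y i) ∧ ∑ i, y i ≤ 1 - s} =
      ENNReal.ofReal ((1 - s) ^ d) * volume (simplex d) := by
  have h : 0 < 1 - s := by linarith
  rw [← smul_simplex h, Measure.addHaar_smul, Module.finrank_fin_fun, abs_of_pos (pow_pos h d)]

/-- Fubini in the first coordinate `s`: the slice is `T^d` scaled by `1 - s`, and `(1 - s)^d`
integrates to `1 / (d + 1)` over `[0, 1]`. -/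
theorem volume_simplex_succ (d : ℕ) :
    volume (simplex (d + 1)) = ENNReal.ofReal (1 / (d + 1)) * volume (simplex d) := by
  have hmp := volume_preserving_piFinSuccAbove (fun _ : Fin (d + 1) => ℝ) 0
  have hm := hmp.symm.measure_preimage (isClosed_simplex (d + 1)).measurableSet.nullMeasurableSet
  rw [← hm, Measure.volume_eq_prod, Measure.prod_apply
    ((MeasurableEquiv.measurable _) (isClosed_simplex (d + 1)).measurableSet)]
  have hslice : ∀ s : ℝ, Prod.mk s ⁻¹' ((MeasurableEquiv.piFinSuccAbove (fun _ : Fin (d + 1) => ℝ)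
      0).symm ⁻¹' simplex (d + 1)) =
      {y : Fin d → ℝ | 0 ≤ s ∧ (∀ i, 0 ≤ y i) ∧ ∑ i, y i ≤ 1 - s} := by
    intro s
    ext y
    simp only [simplex, Set.mem_preimage, Set.mem_ofPred_eq, MeasurableEquiv.piFinSuccAbove_symm_apply,
      Fin.forall_fin_succ, Fin.sum_univ_succ]
    simp [Fin.insertNthEquiv, and_assoc, le_sub_iff_add_le, add_comm]
  simp_rw [hslice]
  -- The scaling formula needs `s < 1` and the indicator omits both end points, so the null set `{0,
  -- 1}` is discarded.
  have hae : (fun s : ℝ => volume {y : Fin d → ℝ | 0 ≤ s ∧ (∀ i, 0 ≤ y i) ∧ ∑ i, y i ≤ 1 - s})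
      =ᵐ[volume] (Set.Ioo (0 : ℝ) 1).indicator
        fun s => ENNReal.ofReal ((1 - s) ^ d) * volume (simplex d) := by
    have hne : ∀ a : ℝ, ∀ᵐ s : ℝ, s ≠ a := fun a => by
      simp [ae_iff]
    filter_upwards [hne 0, hne 1] with s hs0 hs1
    by_cases hs : s ∈ Set.Ioo (0 : ℝ) 1
    · rw [Set.indicator_of_mem hs, ← volume_simplex_slice hs.2]
      simp [hs.1.le]
    · rw [Set.indicator_of_notMem hs]
      convert! measure_empty (μ := (volume : Measure (Fin d → ℝ)))
      rw [Set.eq_empty_iff_forall_notMem]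
      rintro y ⟨h0, hy, hy1⟩
      have := Finset.sum_nonneg fun i (_ : i ∈ Finset.univ) => hy i
      exact hs ⟨lt_of_le_of_ne h0 (Ne.symm hs0), lt_of_le_of_ne (by linarith) hs1⟩
  rw [lintegral_congr_ae hae, lintegral_indicator measurableSet_Ioo,
    lintegral_mul_const _ (by fun_prop)]
  congr 1
  rw [← ofReal_integral_eq_lintegral_ofReal]
  · congr 1
    rw [← integral_Ioc_eq_integral_Ioo, ← intervalIntegral.integral_of_le zero_le_one,
      intervalIntegral.integral_comp_sub_left (fun x => x ^ d)]
    simp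
  · exact (Continuous.integrableOn_Icc (by fun_prop)).mono_set Set.Ioo_subset_Icc_self
  · filter_upwards [ae_restrict_mem measurableSet_Ioo] with s hs
    exact pow_nonneg (by linarith [hs.2]) d

theorem factorial_mul_volume_simplex (d : ℕ) : (d ! : ℝ≥0∞) * volume (simplex d) = 1 := by
  induction d with
  | zero =>
    have : simplex 0 = Set.univ := by ext x; simp [simplex]
    simp [this, volume_pi]
  | succ d ih =>
    have h : ((d + 1 : ℕ) : ℝ≥0∞) * ENNReal.ofReal (1 / (d + 1)) = 1 := by
      rw [← ENNReal.ofReal_natCast, ← ENNReal.ofReal_mul (by positivity), Nat.cast_add_one,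
        mul_one_div_cancel (by positivity), ENNReal.ofReal_one]
    rw [volume_simplex_succ, Nat.factorial_succ, Nat.cast_mul, mul_mul_mul_comm, h, ih, one_mul]

instance (d : ℕ) : IsProbabilityMeasure (simplexMeasure d) := by
  refine ⟨?_⟩
  rw [simplexMeasure, Measure.smul_apply, comap_subtype_coe_apply
    (isClosed_simplex d).measurableSet]
  simpa using factorial_mul_volume_simplex d

/-! ### Markov inequality and the bound for the kernel `P_ℓ` -/

/-- A form of the Markov inequality at the left end point of `[0, 1]`. -/
theorem abs_derivative_eval_le {n : ℕ} {q : Polynomial ℝ} {S : ℝ} (hS : 0 < S)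
    (hdeg : q.natDegree ≤ n) (hq : ∀ s ∈ Set.Icc (0 : ℝ) 1, |q.eval s| ≤ S) {x : ℝ}
    (h0 : 0 ≤ x) (hx : x ≤ 1 / 2) : |q.derivative.eval x| ≤ 4 * n ^ 2 * S := by
  -- The Chebyshev extremal inequality is one-sided; the sign `ε` yields the absolute value.
  have key : ∀ ε : ℝ, |ε| = 1 → ε * q.derivative.eval x * (x - 1) / 2 ≤ n ^ 2 * S := by
    intro ε hε
    -- `L` maps `[-1, 1]` onto `[x, 1]` with `L(1) = x`, so the derivative at `x` is compared with
    -- `T_n'(1) = n^2`.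
    set L : Polynomial ℝ := Polynomial.C ((x - 1) / 2) * Polynomial.X + Polynomial.C ((x + 1) / 2)
    have hL : L.natDegree ≤ 1 := Polynomial.natDegree_linear_le
    have hLe : ∀ t, L.eval t = (x - 1) / 2 * t + (x + 1) / 2 := fun t => by simp [L]
    have := Polynomial.Chebyshev.eval_iterate_derivative_le_of_forall_abs_le_one (n := n) (k := 1)
      (P := Polynomial.C (ε / S) * q.comp L) le_rfl ?_ ?_
    · simp only [Function.iterate_one, Polynomial.Chebyshev.derivative_T_eval_one,
        Polynomial.derivative_C_mul, Polynomial.derivative_comp, Polynomial.eval_mul,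
        Polynomial.eval_C, Polynomial.eval_comp, hLe] at this
      have hd : L.derivative.eval 1 = (x - 1) / 2 := by simp [L]
      rw [hd, show (x - 1) / 2 * 1 + (x + 1) / 2 = x by ring] at this
      calc _ = S * (ε / S * ((x - 1) / 2 * q.derivative.eval x)) := by field_simp
        _ ≤ S * n ^ 2 := by
          refine mul_le_mul_of_nonneg_left ?_ hS.le
          simpa using this
        _ = _ := mul_comm _ _
    · refine Polynomial.degree_le_of_natDegree_le ?_
      refine (Polynomial.natDegree_C_mul_le _ _).trans (Polynomial.natDegree_comp_le.trans ?_)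
      exact (Nat.mul_le_mul hdeg hL).trans (by simp)
    · intro t ht
      rw [Polynomial.eval_mul, Polynomial.eval_C, Polynomial.eval_comp, hLe, abs_mul, abs_div, hε,
        abs_of_pos hS, one_div, inv_mul_le_iff₀ hS, mul_one]
      refine hq _ ⟨?_, ?_⟩ <;> nlinarith [ht.1, ht.2]
  have h1 := key 1 (by simp)
  have h2 := key (-1) (by simp)
  have h3 : |q.derivative.eval x| * (1 - x) ≤ 2 * (n ^ 2 * S) := by
    rcases abs_cases (q.derivative.eval x) with h | h <;> rw [h.1] <;> linarith
  nlinarith [abs_nonneg (q.derivative.eval x)]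

/-- Mean value inequality: the derivative is at most `4 n^2 S` on `[0, 1/2]`, so a step of length `1
/ (8 n^2)` changes `q` by at most `S / 2`. -/
theorem half_le_abs_eval {n : ℕ} (hn : 1 ≤ n) {q : Polynomial ℝ} {S : ℝ} (hS : 0 < S)
    (hdeg : q.natDegree ≤ n) (hq : ∀ s ∈ Set.Icc (0 : ℝ) 1, |q.eval s| ≤ S) (h0 : |q.eval 0| = S) :
    S / 2 ≤ |q.eval (1 / (8 * (n : ℝ) ^ 2))| := by
  have hn' : (1 : ℝ) ≤ n := by exact_mod_cast hn
  have hpos : (0 : ℝ) < 8 * (n : ℝ) ^ 2 := by positivity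
  set s : ℝ := 1 / (8 * (n : ℝ) ^ 2) with hs
  have hs0 : 0 < s := by positivity
  have hs2 : s ≤ 1 / 2 := by
    rw [hs, div_le_div_iff₀ hpos two_pos]
    nlinarith
  have := Convex.norm_image_sub_le_of_norm_deriv_le (f := fun x => q.eval x)
    (s := Set.Icc (0 : ℝ) (1 / 2)) (x := 0) (y := s) (C := 4 * n ^ 2 * S)
    (fun x _ => q.differentiableAt) (fun x hx => by
      rw [Polynomial.deriv, Real.norm_eq_abs]
      exact abs_derivative_eval_le hS hdeg hq hx.1 hx.2)
    (convex_Icc _ _) ⟨le_rfl, by norm_num⟩ ⟨hs0.le, hs2⟩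
  rw [sub_zero, Real.norm_eq_abs, Real.norm_eq_abs, abs_of_pos hs0,
    show 4 * (n : ℝ) ^ 2 * S * s = S / 2 by rw [hs]; field_simp; ring] at this
  have h4 := abs_sub_abs_le_abs_sub (q.eval 0) (q.eval s)
  rw [abs_sub_comm] at h4
  linarith

theorem convex_simplex (d : ℕ) : Convex ℝ (simplex d) := by
  intro x hx y hy a b ha hb hab
  refine ⟨fun i => ?_, ?_⟩
  · have h1 := mul_nonneg ha (hx.1 i)
    have h2 := mul_nonneg hb (hy.1 i)
    simpa using add_nonneg h1 h2
  · have h1 := mul_nonneg ha hx.2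
    have h2 := mul_nonneg hb hy.2
    simp only [Pi.add_apply, Pi.smul_apply, smul_eq_mul, Finset.sum_add_distrib, ← Finset.mul_sum]
    nlinarith

theorem simplexMeasure_apply_preimage {d : ℕ} {A : Set (Fin d → ℝ)} (hA : A ⊆ simplex d) :
    simplexMeasure d (Subtype.val ⁻¹' A) = (d ! : ℝ≥0∞) * volume A := by
  rw [simplexMeasure, Measure.smul_apply, comap_subtype_coe_apply
    (isClosed_simplex d).measurableSet, Subtype.image_preimage_coe,
    Set.inter_eq_self_of_subset_right hA, smul_eq_mul]

/-- The sup norm of a polynomial on the simplex is controlled by its `L₂` norm. -/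
theorem sq_eval_le_polyInner {d ℓ : ℕ} (hℓ : 1 ≤ ℓ) {p : MvPolynomial (Fin d) ℝ}
    (hp : p.totalDegree ≤ ℓ) (y : simplex d) :
    MvPolynomial.eval y.1 p ^ 2 ≤ 4 * (8 * (ℓ : ℝ) ^ 2) ^ d * polyInner d p p := by
  have hpi : 0 ≤ polyInner d p p := integral_nonneg fun x => mul_self_nonneg _
  obtain ⟨x₀, -, hx₀⟩ := isCompact_univ.exists_isMaxOn ⟨y, Set.mem_univ y⟩
    (continuous_polyEval p).abs.continuousOn
  set S := |MvPolynomial.eval x₀.1 p| with hSdef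
  have hmax : ∀ z : simplex d, |MvPolynomial.eval z.1 p| ≤ S := fun z => hx₀ (Set.mem_univ z)
  suffices h : S ^ 2 ≤ 4 * (8 * (ℓ : ℝ) ^ 2) ^ d * polyInner d p p by
    refine le_trans ?_ h
    rw [← sq_abs]
    exact pow_le_pow_left₀ (abs_nonneg _) (hmax y) 2
  rcases (abs_nonneg (MvPolynomial.eval x₀.1 p)).eq_or_lt with hS0 | hS
  · rw [hSdef, ← hS0, zero_pow two_ne_zero]; positivity
  have hℓ' : (0 : ℝ) < ℓ := by exact_mod_cast hℓ
  set s : ℝ := 1 / (8 * (ℓ : ℝ) ^ 2) with hs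
  have hs0 : 0 < s := by positivity
  have hs1 : s ≤ 1 := by
    have : (1 : ℝ) ≤ ℓ := by exact_mod_cast hℓ
    rw [hs, div_le_one (by positivity)]
    nlinarith
  have hseg : ∀ z ∈ simplex d, ∀ a ∈ Set.Icc (0 : ℝ) 1,
      AffineMap.homothety x₀.1 a z ∈ simplex d := by
    intro z hz a ha
    rw [AffineMap.homothety_eq_lineMap]
    exact (convex_simplex d).lineMap_mem x₀.2 hz ha
  -- The copy of `T^d` shrunk by `s` towards the maximum point `x₀`: it stays in `T^d` by convexity
  -- and has normalised measure `s^d`.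
  set A := AffineMap.homothety x₀.1 s '' simplex d with hAdef
  have hAT : A ⊆ simplex d := by
    rintro _ ⟨z, hz, rfl⟩
    exact hseg z hz s ⟨hs0.le, hs1⟩
  have hA : ∀ z ∈ A, S / 2 ≤ |MvPolynomial.eval z p| := by
    rintro _ ⟨z, hz, rfl⟩
    -- The restriction of `p` to the segment from `x₀` to `z`; the parameter `s` gives the point of
    -- `A`.
    set q : Polynomial ℝ := MvPolynomial.aeval (fun i => Polynomial.C (z i - x₀.1 i) * Polynomial.X
      + Polynomial.C (x₀.1 i)) p with hqdef
    have hq : ∀ a, q.eval a = MvPolynomial.eval (AffineMap.homothety x₀.1 a z) p := by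
      intro a
      rw [hqdef, ← Polynomial.coe_evalRingHom, MvPolynomial.aeval_def, MvPolynomial.eval₂_eq,
        map_sum, MvPolynomial.eval_eq]
      refine Finset.sum_congr rfl fun e _ => ?_
      rw [map_mul, map_prod]
      congr 1
      · simp
      · refine Finset.prod_congr rfl fun i _ => ?_
        simp [AffineMap.homothety_apply]
        ring
    have hdeg : q.natDegree ≤ ℓ := by
      have := MvPolynomial.aeval_natDegree_le (n := 1) p hp
        (fun i => Polynomial.C (z i - x₀.1 i) * Polynomial.X + Polynomial.C (x₀.1 i))
        (fun i => Polynomial.natDegree_linear_le)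
      rwa [mul_one] at this
    rw [← hq]
    refine half_le_abs_eval hℓ hS hdeg (fun a ha => ?_) ?_
    · rw [hq]
      exact hmax ⟨_, hseg z hz a ha⟩
    · rw [hq]
      simp [hSdef]
  have hvol : simplexMeasure d (Subtype.val ⁻¹' A) = ENNReal.ofReal (s ^ d) := by
    rw [simplexMeasure_apply_preimage hAT, Measure.addHaar_image_homothety, Module.finrank_fin_fun,
      abs_of_pos (pow_pos hs0 d), mul_left_comm, factorial_mul_volume_simplex, mul_one]
  have hAc : MeasurableSet A :=
    ((isCompact_simplex d).image (AffineMap.homothety_continuous x₀.1 s)).measurableSet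
  have hint : s ^ d * (S / 2) ^ 2 ≤ polyInner d p p := by
    rw [polyInner_apply]
    calc s ^ d * (S / 2) ^ 2
        = ∫ x in Subtype.val ⁻¹' A, (S / 2) ^ 2 ∂simplexMeasure d := by
          rw [setIntegral_const, smul_eq_mul, Measure.real, hvol,
            ENNReal.toReal_ofReal (pow_nonneg hs0.le d)]
      _ ≤ ∫ x in Subtype.val ⁻¹' A, MvPolynomial.eval x.1 p * MvPolynomial.eval x.1 p
            ∂simplexMeasure d := by
          refine setIntegral_mono_on (integrable_const _) (integrable_polyEval_mul p p).integrableOn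
            (measurable_subtype_coe hAc) fun x hx => ?_
          rw [← sq, ← sq_abs (MvPolynomial.eval x.1 p)]
          exact pow_le_pow_left₀ (by positivity) (hA x.1 hx) 2
      _ ≤ _ := setIntegral_le_integral (integrable_polyEval_mul p p)
          (Filter.Eventually.of_forall fun x => mul_self_nonneg _)
  calc S ^ 2 = 4 * (8 * (ℓ : ℝ) ^ 2) ^ d * (s ^ d * (S / 2) ^ 2) := by
        have : (8 * (ℓ : ℝ) ^ 2) ^ d * s ^ d = 1 := by
          rw [← mul_pow, hs, mul_one_div_cancel (by positivity), one_pow]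
        linear_combination (-S ^ 2) * this
    _ ≤ _ := mul_le_mul_of_nonneg_left hint (by positivity)

theorem P_mem_orthoPoly (d ℓ : ℕ) (k : Fin (orthoDim d ℓ)) : P d ℓ k ∈ orthoPoly d ℓ := by
  rw [← span_P]
  exact Submodule.subset_span ⟨k, rfl⟩

/-- The polynomial `x ↦ P_ℓ(x, y)`. -/
noncomputable def kernelPoly (d ℓ : ℕ) (y : simplex d) : MvPolynomial (Fin d) ℝ :=
  ∑ k, MvPolynomial.eval y.1 (P d ℓ k) • P d ℓ k

theorem eval_kernelPoly (d ℓ : ℕ) (x y : simplex d) :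
    MvPolynomial.eval x.1 (kernelPoly d ℓ y) = kernelP d ℓ x y := by
  simp [kernelPoly, kernelP, MvPolynomial.smul_eval, mul_comm]

theorem kernelPoly_mem_orthoPoly (d ℓ : ℕ) (y : simplex d) : kernelPoly d ℓ y ∈ orthoPoly d ℓ :=
  Submodule.sum_mem _ fun k _ => Submodule.smul_mem _ _ (P_mem_orthoPoly d ℓ k)

theorem polyInner_kernelPoly (d ℓ : ℕ) (y : simplex d) :
    polyInner d (kernelPoly d ℓ y) (kernelPoly d ℓ y) = kernelP d ℓ y y := by
  simp [kernelPoly, kernelP, P_orthonormal]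

theorem kernelP_self_nonneg (d ℓ : ℕ) (x : simplex d) : 0 ≤ kernelP d ℓ x x :=
  Finset.sum_nonneg fun _ _ => mul_self_nonneg _

/-- The polynomial `P_ℓ(·, y)` has both its value at `y` and its squared norm equal to `P_ℓ(y, y)`.
The sup-norm estimate becomes quadratic in this number, and one factor cancels. -/
theorem kernelP_self_le {d ℓ : ℕ} (hℓ : 1 ≤ ℓ) (y : simplex d) :
    kernelP d ℓ y y ≤ 4 * (8 * (ℓ : ℝ) ^ 2) ^ d := by
  have h := sq_eval_le_polyInner hℓ (kernelPoly_mem_orthoPoly d ℓ y).1 y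
  rw [eval_kernelPoly, polyInner_kernelPoly] at h
  rcases (kernelP_self_nonneg d ℓ y).eq_or_lt with h0 | h0
  · rw [← h0]; positivity
  · exact le_of_mul_le_mul_right (by rwa [← sq]) h0

theorem kernelP_le_half_add (d ℓ : ℕ) (x y : simplex d) :
    kernelP d ℓ x y ≤ (kernelP d ℓ x x + kernelP d ℓ y y) / 2 := by
  rw [kernelP, kernelP, kernelP, ← Finset.sum_add_distrib, Finset.sum_div]
  refine Finset.sum_le_sum fun k _ => ?_
  nlinarith [sq_nonneg (MvPolynomial.eval x.1 (P d ℓ k) - MvPolynomial.eval y.1 (P d ℓ k))]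

theorem exists_isKernelBound (d : ℕ) : ∃ M : ℝ, IsKernelBound d M := by
  refine ⟨4 * 8 ^ d, fun ℓ hℓ x y => ?_⟩
  have h1 := kernelP_self_le hℓ x
  have h2 := kernelP_self_le hℓ y
  rw [mul_pow, ← pow_mul] at h1 h2
  linarith [kernelP_le_half_add d ℓ x y]

/-- `P_0(·, x)` is a constant `c`, and total mass 1 gives `c^2 = c`. -/
theorem kernelP_zero_self_le_one {d : ℕ} (x : simplex d) : kernelP d 0 x x ≤ 1 := by
  obtain ⟨c, hc⟩ : ∃ c, kernelPoly d 0 x = MvPolynomial.C c :=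
    ⟨_, MvPolynomial.totalDegree_eq_zero_iff_eq_C.mp
      (Nat.le_zero.mp (kernelPoly_mem_orthoPoly d 0 x).1)⟩
  have h1 := eval_kernelPoly d 0 x x
  have h2 := polyInner_kernelPoly d 0 x
  rw [hc] at h1 h2
  simp only [MvPolynomial.eval_C] at h1
  simp only [polyInner_apply, MvPolynomial.eval_C, integral_const, probReal_univ, one_smul] at h2
  nlinarith

/-! ### Completeness of the product polynomials -/

instance (d m : ℕ) : IsProbabilityMeasure (prodMeasure d m) := by
  unfold prodMeasure; infer_instance

theorem polyInner_comm (d : ℕ) (p q : MvPolynomial (Fin d) ℝ) :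
    polyInner d p q = polyInner d q p := by
  simp [polyInner_apply, mul_comm]

/-- Orthogonal projection of a polynomial onto a finite-dimensional space of polynomials. -/
theorem exists_polyInner_sub_eq_zero {d : ℕ} (W : Submodule ℝ (MvPolynomial (Fin d) ℝ))
    [FiniteDimensional ℝ W] (p : MvPolynomial (Fin d) ℝ) :
    ∃ w ∈ W, ∀ q ∈ W, polyInner d (p - w) q = 0 := by
  -- Positive definiteness makes `W` inject into its dual, hence onto it by dimension; `w`
  -- represents the functional `⟨p, ·⟩`.
  have hinj : Function.Injective ((polyInner d).restrict W) := by
    rw [← LinearMap.ker_eq_bot, LinearMap.ker_eq_bot']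
    intro w hw
    by_contra hne
    have hpos := polyInner_self_pos (p := w.1) fun h => hne (Subtype.ext h)
    exact hpos.ne' (DFunLike.congr_fun hw w)
  have hsurj : Function.Surjective ((polyInner d).restrict W) :=
    (LinearMap.injective_iff_surjective_of_finrank_eq_finrank
      (Subspace.dual_finrank_eq (K := ℝ) (V := W)).symm).mp hinj
  obtain ⟨w, hw⟩ := hsurj ((polyInner d p).comp W.subtype)
  refine ⟨w, w.2, fun q hq => ?_⟩
  have h := DFunLike.congr_fun hw ⟨q, hq⟩
  have h' : polyInner d w q = polyInner d p q := h
  simp [h']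

/-- Gram–Schmidt by degree: subtracting the projection onto degree at most `n` leaves an element of
`V_{n+1}`. -/
theorem mem_iSup_orthoPoly {d : ℕ} (n : ℕ) : ∀ p : MvPolynomial (Fin d) ℝ, p.totalDegree ≤ n →
    p ∈ ⨆ ℓ, orthoPoly d ℓ := by
  induction n with
  | zero =>
    intro p hp
    refine Submodule.mem_iSup_of_mem 0 ⟨hp, fun q hq => absurd hq (Nat.not_lt_zero _)⟩
  | succ n ih =>
    intro p hp
    obtain ⟨w, hw, hpw⟩ := exists_polyInner_sub_eq_zero
      (MvPolynomial.restrictTotalDegree (Fin d) ℝ n) p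
    rw [MvPolynomial.mem_restrictTotalDegree] at hw
    rw [← sub_add_cancel p w]
    refine Submodule.add_mem _ (Submodule.mem_iSup_of_mem (n + 1) ⟨?_, fun q hq => ?_⟩) (ih w hw)
    · exact (MvPolynomial.totalDegree_sub p w).trans (max_le hp (hw.trans n.le_succ))
    · exact hpw q ((MvPolynomial.mem_restrictTotalDegree _ _ _).mpr (Nat.lt_succ_iff.mp hq))

theorem span_range_P (d : ℕ) : Submodule.span ℝ
    (Set.range fun a : Σ ℓ, Fin (orthoDim d ℓ) => P d a.1 a.2) = ⊤ := by
  rw [eq_top_iff]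
  rintro p -
  refine (iSup_le fun ℓ => ?_ : ⨆ ℓ, orthoPoly d ℓ ≤ _) (mem_iSup_orthoPoly _ p le_rfl)
  rw [← span_P]
  refine Submodule.span_mono ?_
  rintro _ ⟨k, rfl⟩
  exact ⟨⟨ℓ, k⟩, rfl⟩

/-- The continuous function `x ↦ ∏_j p_j(x_j)` on `(T^d)^m`. -/
noncomputable def prodPoly {d m : ℕ} (p : Fin m → MvPolynomial (Fin d) ℝ) :
    C(Fin m → simplex d, ℝ) where
  toFun x := ∏ j, MvPolynomial.eval (x j).1 (p j)
  continuous_toFun := continuous_finsetProd _ fun j _ =>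
    (continuous_polyEval (p j)).comp (continuous_apply j)

theorem prodPoly_apply {d m : ℕ} (p : Fin m → MvPolynomial (Fin d) ℝ) (x : Fin m → simplex d) :
    prodPoly p x = ∏ j, MvPolynomial.eval (x j).1 (p j) := rfl

/-- The orthonormal system `x ↦ ∏_j P_{ℓ_j,k_j}(x_j)`. -/
noncomputable def prodP {d m : ℕ} (ℓ : Fin m → ℕ) (k : ∀ j, Fin (orthoDim d (ℓ j))) :
    C(Fin m → simplex d, ℝ) :=
  prodPoly fun j => P d (ℓ j) (k j)

/-- Integration against a fixed integrable function, on continuous functions. -/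
noncomputable def integralMul {X : Type*} [TopologicalSpace X] [CompactSpace X] [MeasurableSpace X]
    [OpensMeasurableSpace X] {μ : Measure X} {h : X → ℝ}
    (hh : Integrable h μ) : C(X, ℝ) →L[ℝ] ℝ :=
  have hi : ∀ g : C(X, ℝ), Integrable (fun x => h x * g x) μ := fun g =>
    hh.mul_bdd (c := ‖g‖) g.continuous.aestronglyMeasurable
      (Filter.Eventually.of_forall fun x => g.norm_coe_le_norm x)
  LinearMap.mkContinuous
    { toFun := fun g => ∫ x, h x * g x ∂μ
      map_add' := fun f g => by
        rw [← integral_add (hi f) (hi g)]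
        simp [mul_add]
      map_smul' := fun c g => by
        rw [RingHom.id_apply, smul_eq_mul, ← integral_const_mul]
        simp [mul_left_comm] }
    (∫ x, |h x| ∂μ) fun g => by
      refine (norm_integral_le_integral_norm _).trans ?_
      rw [← integral_mul_const]
      refine integral_mono (hi g).norm (hh.abs.mul_const _) fun x => ?_
      simp only [norm_mul, Real.norm_eq_abs]
      exact mul_le_mul_of_nonneg_left (g.norm_coe_le_norm x) (abs_nonneg _)

theorem integralMul_apply {X : Type*} [TopologicalSpace X] [CompactSpace X] [MeasurableSpace X]
    [OpensMeasurableSpace X] {μ : Measure X} {h : X → ℝ}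
    (hh : Integrable h μ) (g : C(X, ℝ)) : integralMul hh g = ∫ x, h x * g x ∂μ := rfl

theorem prodPoly_mem_span {d m : ℕ} (p : Fin m → MvPolynomial (Fin d) ℝ) :
    prodPoly p ∈ Submodule.span ℝ (Set.range fun a : Σ ℓ : Fin m → ℕ, ∀ j, Fin (orthoDim d (ℓ j)) =>
      prodP a.1 a.2) := by
  have hp : ∀ j, ∃ c : (Σ ℓ, Fin (orthoDim d ℓ)) →₀ ℝ,
      ∑ a ∈ c.support, c a • P d a.1 a.2 = p j := fun j => by
    have : p j ∈ Submodule.span ℝ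
      (Set.range fun a : Σ ℓ, Fin (orthoDim d ℓ) => P d a.1 a.2) := by
      rw [span_range_P]; trivial
    exact Finsupp.mem_span_range_iff_exists_finsupp.mp this
  choose c hc using hp
  have h : prodPoly p = ∑ a ∈ Fintype.piFinset fun j => (c j).support,
      (∏ j, c j (a j)) • prodP (fun j => (a j).1) (fun j => (a j).2) := by
    ext x
    simp only [ContinuousMap.sum_apply, ContinuousMap.smul_apply, prodPoly_apply, prodP,
      smul_eq_mul, ← Finset.prod_mul_distrib]
    rw [← Finset.prod_univ_sum (fun j => (c j).support)
      fun j a => c j a * MvPolynomial.eval (x j).1 (P d a.1 a.2)]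
    refine Finset.prod_congr rfl fun j _ => ?_
    rw [← hc j]
    simp [MvPolynomial.smul_eval]
  rw [h]
  exact Submodule.sum_mem _ fun a _ => Submodule.smul_mem _ _
    (Submodule.subset_span ⟨⟨fun j => (a j).1, fun j => (a j).2⟩, rfl⟩)

/-- The multiplicative monoid of the functions `x ↦ ∏_j p_j(x_j)`. -/
noncomputable def prodPolyMonoid (d m : ℕ) : Submonoid C(Fin m → simplex d, ℝ) where
  carrier := Set.range prodPoly
  one_mem' := ⟨fun _ => 1, by ext x; simp [prodPoly_apply]⟩
  mul_mem' := by
    rintro _ _ ⟨p, rfl⟩ ⟨q, rfl⟩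
    exact ⟨fun j => p j * q j, by ext x; simp [prodPoly_apply, Finset.prod_mul_distrib]⟩

theorem separatesPoints_prodPoly (d m : ℕ) :
    (Algebra.adjoin ℝ (prodPolyMonoid d m : Set C(Fin m → simplex d, ℝ))).SeparatesPoints := by
  intro x y hxy
  obtain ⟨j, hj⟩ := Function.ne_iff.mp hxy
  obtain ⟨i, hi⟩ := Function.ne_iff.mp fun h => hj (Subtype.ext h)
  -- A coordinate function is a product with `X i` in factor `j` and 1 elsewhere.
  have hval : ∀ z : Fin m → simplex d,
      prodPoly (Function.update (fun _ => 1) j (MvPolynomial.X i)) z = (z j).1 i := by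
    intro z
    rw [prodPoly_apply, Finset.prod_eq_single j]
    · simp
    · intro b _ hb
      simp [Function.update_of_ne hb]
    · simp
  refine ⟨_, ⟨_, Algebra.subset_adjoin
    ⟨Function.update (fun _ => 1) j (MvPolynomial.X i), rfl⟩, rfl⟩, ?_⟩
  simpa only [hval] using hi

/-- Stone–Weierstrass: the functions `prodPoly p` are closed under multiplication, so the algebra
they generate is their linear span, and this is dense. -/
theorem continuousLinearMap_eq_zero_of_prodP {d m : ℕ} {L : C(Fin m → simplex d, ℝ) →L[ℝ] ℝ}
    (hL : ∀ ℓ k, L (prodP ℓ k) = 0) : L = 0 := by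
  have hspan : ∀ g ∈ Submodule.span ℝ
      (Set.range fun a : Σ ℓ : Fin m → ℕ, ∀ j, Fin (orthoDim d (ℓ j)) => prodP a.1 a.2),
      L g = 0 := by
    intro g hg
    have : Submodule.span ℝ (Set.range fun a : Σ ℓ : Fin m → ℕ, ∀ j, Fin (orthoDim d (ℓ j)) =>
        prodP a.1 a.2) ≤ LinearMap.ker L.toLinearMap := by
      rw [Submodule.span_le]
      rintro _ ⟨a, rfl⟩
      exact hL a.1 a.2
    exact this hg
  have hadj : ∀ g ∈ Algebra.adjoin ℝ (prodPolyMonoid d m : Set C(Fin m → simplex d, ℝ)),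
      L g = 0 := by
    intro g hg
    refine hspan g ?_
    rw [← Subalgebra.mem_toSubmodule, Algebra.adjoin_eq_span, Submonoid.closure_eq] at hg
    refine Submodule.span_le.mpr ?_ hg
    rintro _ ⟨p, rfl⟩
    exact prodPoly_mem_span p
  have htop := ContinuousMap.subalgebra_topologicalClosure_eq_top_of_separatesPoints _
    (separatesPoints_prodPoly d m)
  ext g
  have hg : g ∈ (Algebra.adjoin ℝ
      (prodPolyMonoid d m : Set C(Fin m → simplex d, ℝ))).topologicalClosure := by
    rw [htop]; trivial
  exact closure_minimal (t := {g | L g = 0}) hadj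
    (isClosed_eq L.continuous continuous_const) hg

theorem integrable_coe_Lp {d m : ℕ} (u : Lp ℝ 2 (prodMeasure d m)) :
    Integrable u (prodMeasure d m) :=
  (Lp.memLp u).integrable (by norm_num)

/-- The products of the orthonormal polynomials are complete in `L₂((T^d)^m)`. -/
theorem eq_zero_of_coeff_eq_zero {d m : ℕ} {u : Lp ℝ 2 (prodMeasure d m)}
    (hu : ∀ ℓ k, coeff ℓ k u = 0) : u = 0 := by
  have hL : integralMul (integrable_coe_Lp u) = 0 := continuousLinearMap_eq_zero_of_prodP hu
  have hdense := ContinuousMap.toLp_denseRange (p := 2) ℝ (prodMeasure d m) ℝ (by norm_num)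
  refine hdense.eq_zero_of_inner_left ℝ fun g => ?_
  have hg : ∫ x, u x * g x ∂prodMeasure d m = 0 := DFunLike.congr_fun hL g
  rw [L2.inner_def, ← hg]
  refine integral_congr_ae ?_
  filter_upwards [ContinuousMap.coeFn_toLp (p := 2) (𝕜 := ℝ) (prodMeasure d m) g] with x hx
  rw [hx]
  simp [mul_comm]

/-! ### Uniform convergence and duality for weighted series -/

section WeightedSeries

variable {X Λ : Type*} [TopologicalSpace X] {K : Λ → Type*} [∀ ℓ, Fintype (K ℓ)]

/-- With `α ℓ = ∑ k, W ℓ * a ℓ k ^ 2`, Cauchy–Schwarz bounds the `ℓ`-th block in sup norm by `√(α b)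
≤ (α + b) / 2`, which is summable. -/
theorem summable_sum_smul [CompactSpace X] {ψ : ∀ ℓ, K ℓ → C(X, ℝ)} {a : ∀ ℓ, K ℓ → ℝ} {W b : Λ → ℝ}
    (hW : ∀ ℓ, 0 < W ℓ) (hψ : ∀ ℓ x, ∑ k, ψ ℓ k x ^ 2 ≤ W ℓ * b ℓ) (hb0 : ∀ ℓ, 0 ≤ b ℓ)
    (hb : Summable b) (ha : Summable fun ℓ => ∑ k, W ℓ * a ℓ k ^ 2) :
    Summable fun ℓ => ∑ k, a ℓ k • ψ ℓ k := by
  refine Summable.of_norm_bounded ((ha.add hb).div_const 2) fun ℓ => ?_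
  have hα : 0 ≤ ∑ k, W ℓ * a ℓ k ^ 2 :=
    Finset.sum_nonneg fun k _ => mul_nonneg (hW ℓ).le (sq_nonneg _)
  have hαb : 0 ≤ (∑ k, W ℓ * a ℓ k ^ 2 + b ℓ) / 2 := by linarith [hb0 ℓ]
  rw [ContinuousMap.norm_le _ hαb]
  intro x
  rw [Real.norm_eq_abs]
  refine abs_le_of_sq_le_sq ?_ hαb
  simp only [ContinuousMap.sum_apply, ContinuousMap.smul_apply, smul_eq_mul]
  calc (∑ k, a ℓ k * ψ ℓ k x) ^ 2 ≤ (∑ k, a ℓ k ^ 2) * ∑ k, ψ ℓ k x ^ 2 :=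
        Finset.sum_mul_sq_le_sq_mul_sq _ _ _
    _ ≤ (∑ k, a ℓ k ^ 2) * (W ℓ * b ℓ) :=
        mul_le_mul_of_nonneg_left (hψ ℓ x) (Finset.sum_nonneg fun k _ => sq_nonneg _)
    _ = (∑ k, W ℓ * a ℓ k ^ 2) * b ℓ := by rw [← Finset.mul_sum]; ring
    _ ≤ _ := by nlinarith [sq_nonneg (∑ k, W ℓ * a ℓ k ^ 2 - b ℓ)]

theorem summable_of_tsum_ofReal_ne_top {f : ∀ ℓ, K ℓ → ℝ} (hf : ∀ ℓ k, 0 ≤ f ℓ k)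
    (h : ∑' ℓ, ∑ k, ENNReal.ofReal (f ℓ k) ≠ ⊤) : Summable fun ℓ => ∑ k, f ℓ k := by
  have := ENNReal.summable_toReal h
  refine this.congr fun ℓ => ?_
  rw [← ENNReal.ofReal_sum_of_nonneg fun k _ => hf ℓ k,
    ENNReal.toReal_ofReal (Finset.sum_nonneg fun k _ => hf ℓ k)]

/-- Cauchy–Schwarz for a functional applied to a weighted orthogonal series. -/
theorem ofReal_sq_map_tsum_le {ψ : ∀ ℓ, K ℓ → C(X, ℝ)} {a : ∀ ℓ, K ℓ → ℝ} {W : Λ → ℝ}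
    (hW : ∀ ℓ, 0 < W ℓ) (hs : Summable fun ℓ => ∑ k, a ℓ k • ψ ℓ k)
    (ha : ∑' ℓ, ∑ k, ENNReal.ofReal (W ℓ * a ℓ k ^ 2) ≤ 1) (T : C(X, ℝ) →L[ℝ] ℝ) :
    ENNReal.ofReal (T (∑' ℓ, ∑ k, a ℓ k • ψ ℓ k) ^ 2) ≤
      ∑' ℓ, ∑ k, ENNReal.ofReal (T (ψ ℓ k) ^ 2 / W ℓ) := by
  have hT : Filter.Tendsto (fun s : Finset Λ =>
      ENNReal.ofReal ((∑ ℓ ∈ s, T (∑ k, a ℓ k • ψ ℓ k)) ^ 2)) Filter.atTop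
      (nhds (ENNReal.ofReal (T (∑' ℓ, ∑ k, a ℓ k • ψ ℓ k) ^ 2))) :=
    ENNReal.tendsto_ofReal ((hs.hasSum.mapL T).pow 2)
  refine le_of_tendsto' hT fun s => ?_
  have hf : ∀ b ∈ s.sigma fun ℓ => (Finset.univ : Finset (K ℓ)),
      0 ≤ W b.1 * a b.1 b.2 ^ 2 := fun b _ => mul_nonneg (hW _).le (sq_nonneg _)
  have hg : ∀ b ∈ s.sigma fun ℓ => (Finset.univ : Finset (K ℓ)),
      0 ≤ T (ψ b.1 b.2) ^ 2 / W b.1 := fun b _ => div_nonneg (sq_nonneg _) (hW _).le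
  -- Finite Cauchy–Schwarz, with `a * T ψ` split into `√W * a` and `T ψ / √W`.
  have hcs := Finset.sum_sq_le_sum_mul_sum_of_sq_le_mul
    (s.sigma fun ℓ => (Finset.univ : Finset (K ℓ))) (r := fun b => a b.1 b.2 * T (ψ b.1 b.2))
    hf hg fun b _ => le_of_eq (by have := (hW b.1).ne'; field_simp)
  have heq : ∑ ℓ ∈ s, T (∑ k, a ℓ k • ψ ℓ k) =
      ∑ b ∈ s.sigma fun ℓ => (Finset.univ : Finset (K ℓ)), a b.1 b.2 * T (ψ b.1 b.2) := by
    rw [Finset.sum_sigma]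
    simp
  rw [heq]
  refine (ENNReal.ofReal_le_ofReal hcs).trans ?_
  rw [ENNReal.ofReal_mul (Finset.sum_nonneg hf), ENNReal.ofReal_sum_of_nonneg hf,
    ENNReal.ofReal_sum_of_nonneg hg, Finset.sum_sigma, Finset.sum_sigma]
  calc _ ≤ 1 * ∑' ℓ, ∑ k, ENNReal.ofReal (T (ψ ℓ k) ^ 2 / W ℓ) :=
        mul_le_mul' ((ENNReal.sum_le_tsum s).trans ha) (ENNReal.sum_le_tsum s)
    _ = _ := one_mul _

end WeightedSeries

/-! ### Averaging over random points -/

section Averaging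

open ProbabilityTheory

variable {X : Type*} [TopologicalSpace X] [CompactSpace X] [MeasurableSpace X] [BorelSpace X]
  {μ : Measure X} [IsProbabilityMeasure μ]

theorem memLp_continuousMap (g : C(X, ℝ)) (p : ℝ≥0∞) : MemLp g p μ :=
  MemLp.of_bound g.continuous.aestronglyMeasurable ‖g‖
    (Filter.Eventually.of_forall fun x => g.norm_coe_le_norm x)

/-- The mean square error of the Monte Carlo method with `n` independent points. -/
theorem lintegral_sq_error (g : C(X, ℝ)) {n : ℕ} (hn : 1 ≤ n) :
    ∫⁻ t : Fin n → X, ENNReal.ofReal ((∫ x, g x ∂μ - 1 / (n : ℝ) * ∑ i, g (t i)) ^ 2)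
      ∂Measure.pi (fun _ => μ) = ENNReal.ofReal (1 / n * Var[g; μ]) := by
  have hn' : (n : ℝ) ≠ 0 := by exact_mod_cast (Nat.one_le_iff_ne_zero.mp hn)
  have hmem : ∀ i : Fin n, MemLp (fun t : Fin n → X => g (t i)) 2 (Measure.pi fun _ => μ) :=
    fun i => (memLp_continuousMap g 2).comp_measurePreserving (measurePreserving_eval _ i)
  have hsum : MemLp (∑ i : Fin n, fun t : Fin n → X => g (t i)) 2 (Measure.pi fun _ => μ) :=
    memLp_finsetSum' _ fun i _ => hmem i
  have hvar := variance_sum_pi (μ := fun _ : Fin n => μ) (X := fun _ => g)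
    fun _ => memLp_continuousMap g 2
  have hmean : ∫ t : Fin n → X, (1 / (n : ℝ) * (∑ i : Fin n, fun t : Fin n → X => g (t i)) t)
      ∂Measure.pi (fun _ => μ) = ∫ x, g x ∂μ := by
    rw [integral_const_mul]
    simp only [Finset.sum_apply]
    rw [integral_finsetSum _ fun i _ => (hmem i).integrable (by norm_num)]
    have hcomp : ∀ i : Fin n, ∫ t : Fin n → X, g (t i) ∂Measure.pi (fun _ => μ) = ∫ x, g x ∂μ :=
      fun i => integral_comp_eval (μ := fun _ : Fin n => μ) (i := i) (f := g)
        g.continuous.aestronglyMeasurable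
    simp [hcomp, hn']
  have h2 := evariance_eq_lintegral_ofReal
    (fun t => 1 / (n : ℝ) * (∑ i : Fin n, fun t : Fin n → X => g (t i)) t)
    (Measure.pi fun _ => μ)
  rw [hmean, ← (hsum.const_mul _).ofReal_variance_eq, variance_const_mul, hvar] at h2
  rw [show 1 / (n : ℝ) * Var[g; μ] = (1 / (n : ℝ)) ^ 2 * ∑ _i : Fin n, Var[g; μ] by
    rw [Finset.sum_const, Finset.card_univ, Fintype.card_fin, nsmul_eq_mul]; field_simp, h2]
  refine lintegral_congr fun t => ?_
  rw [Finset.sum_apply, sub_sq_comm]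

/-- Some point set is at least as good as the average one. -/
theorem exists_points_tsum_sq_error_le {Λ : Type*} [Countable Λ] {K : Λ → Type*}
    [∀ ℓ, Fintype (K ℓ)] [SecondCountableTopology X] {ψ : ∀ ℓ, K ℓ → C(X, ℝ)} {W b : Λ → ℝ}
    (hW : ∀ ℓ, 0 < W ℓ) (hψ : ∀ ℓ x, ∑ k, ψ ℓ k x ^ 2 ≤ W ℓ * b ℓ) (hb0 : ∀ ℓ, 0 ≤ b ℓ)
    {S : ℝ} (hb : HasSum b S) (ℓ₀ : Λ) (hℓ₀ : ∀ k, Var[ψ ℓ₀ k; μ] = 0) {n : ℕ} (hn : 1 ≤ n) :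
    ∃ t : Fin n → X, ∑' ℓ, ∑ k, ENNReal.ofReal
      ((∫ x, ψ ℓ k x ∂μ - 1 / (n : ℝ) * ∑ i, ψ ℓ k (t i)) ^ 2 / W ℓ) ≤
        ENNReal.ofReal (1 / n * (S - b ℓ₀)) := by
  classical
  have hmeas : ∀ ℓ k, Measurable fun t : Fin n → X => ENNReal.ofReal
      ((∫ x, ψ ℓ k x ∂μ - 1 / (n : ℝ) * ∑ i, ψ ℓ k (t i)) ^ 2 / W ℓ) := fun ℓ k => by
    refine ENNReal.measurable_ofReal.comp (Continuous.measurable ?_)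
    fun_prop
  obtain ⟨t, ht⟩ := exists_le_lintegral (μ := Measure.pi fun _ : Fin n => μ)
    (Measurable.tsum (L := .unconditional _) fun ℓ =>
      Finset.measurable_fun_sum _ fun k _ => hmeas ℓ k).aemeasurable
  refine ⟨t, ht.trans ?_⟩
  rw [lintegral_tsum fun ℓ => (Finset.measurable_fun_sum _ fun k _ => hmeas ℓ k).aemeasurable]
  have hterm : ∀ ℓ k, ∫⁻ t : Fin n → X, ENNReal.ofReal
      ((∫ x, ψ ℓ k x ∂μ - 1 / (n : ℝ) * ∑ i, ψ ℓ k (t i)) ^ 2 / W ℓ) ∂Measure.pi (fun _ => μ) =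
      ENNReal.ofReal (1 / n * (Var[ψ ℓ k; μ] / W ℓ)) := fun ℓ k => by
    simp_rw [div_eq_mul_inv _ (W ℓ), ENNReal.ofReal_mul (sq_nonneg _)]
    rw [lintegral_mul_const' _ _ ENNReal.ofReal_ne_top, lintegral_sq_error _ hn,
      ← ENNReal.ofReal_mul (mul_nonneg (by positivity) (variance_nonneg _ _)), mul_assoc]
  -- Replacing `b ℓ₀` by 0 records that the block `ℓ₀` has no variance; this is the source of the
  -- subtracted term.
  have hsum : ∀ ℓ, ∑ k, Var[ψ ℓ k; μ] / W ℓ ≤ Function.update b ℓ₀ 0 ℓ := by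
    intro ℓ
    rcases eq_or_ne ℓ ℓ₀ with rfl | hne
    · simp [hℓ₀]
    · rw [Function.update_of_ne hne, ← Finset.sum_div, div_le_iff₀ (hW ℓ), mul_comm]
      calc ∑ k, Var[ψ ℓ k; μ] ≤ ∑ k, ∫ x, ψ ℓ k x ^ 2 ∂μ :=
            Finset.sum_le_sum fun k _ => variance_le_expectation_sq
              (ψ ℓ k).continuous.aestronglyMeasurable
        _ = ∫ x, ∑ k, ψ ℓ k x ^ 2 ∂μ :=
            (integral_finsetSum _ fun k _ => (memLp_continuousMap (ψ ℓ k) 2).integrable_sq).symm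
        _ ≤ ∫ _x, W ℓ * b ℓ ∂μ := by
            refine integral_mono (integrable_finsetSum _ fun k _ =>
              (memLp_continuousMap (ψ ℓ k) 2).integrable_sq) (integrable_const _) fun x => hψ ℓ x
        _ = W ℓ * b ℓ := by simp
  have hn0 : (0 : ℝ) ≤ 1 / n := by positivity
  calc ∑' ℓ, ∫⁻ t : Fin n → X, ∑ k, ENNReal.ofReal
        ((∫ x, ψ ℓ k x ∂μ - 1 / (n : ℝ) * ∑ i, ψ ℓ k (t i)) ^ 2 / W ℓ) ∂Measure.pi (fun _ => μ)
      ≤ ∑' ℓ, ENNReal.ofReal (1 / n * Function.update b ℓ₀ 0 ℓ) := by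
        refine ENNReal.tsum_le_tsum fun ℓ => ?_
        rw [lintegral_finsetSum _ fun k _ => hmeas ℓ k]
        simp only [hterm]
        rw [← ENNReal.ofReal_sum_of_nonneg fun k _ =>
          mul_nonneg hn0 (div_nonneg (variance_nonneg _ _) (hW ℓ).le), ← Finset.mul_sum]
        exact ENNReal.ofReal_le_ofReal (mul_le_mul_of_nonneg_left (hsum ℓ) hn0)
    _ = ENNReal.ofReal (1 / n * (S - b ℓ₀)) := by
        have hup := (hb.update ℓ₀ 0).mul_left (1 / (n : ℝ))
        rw [← ENNReal.ofReal_tsum_of_nonneg _ hup.summable, hup.tsum_eq]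
        · ring_nf
        · intro ℓ
          refine mul_nonneg hn0 ?_
          rcases eq_or_ne ℓ ℓ₀ with rfl | hne
          · simp
          · rw [Function.update_of_ne hne]; exact hb0 ℓ

end Averaging

/-! ### The constant `c_{d,r}` and sums over multi-indices -/

theorem hasSum_mul_of_nonneg {α β : Type*} {f : α → ℝ} {g : β → ℝ} {s t : ℝ} (hf : HasSum f s)
    (hg : HasSum g t) (hf0 : ∀ a, 0 ≤ f a) (hg0 : ∀ b, 0 ≤ g b) :
    HasSum (fun x : α × β => f x.1 * g x.2) (s * t) :=
  hf.mul hg (hf.summable.mul_of_nonneg hg.summable hf0 hg0)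

theorem hasSum_prod_pi {m : ℕ} {f : Fin m → ℕ → ℝ} {s : Fin m → ℝ} (h0 : ∀ j i, 0 ≤ f j i)
    (hf : ∀ j, HasSum (f j) (s j)) :
    HasSum (fun ℓ : Fin m → ℕ => ∏ j, f j (ℓ j)) (∏ j, s j) := by
  induction m with
  | zero => simp
  | succ m ih =>
    have h := ih (f := fun j => f j.succ) (s := fun j => s j.succ) (fun j => h0 j.succ)
      fun j => hf j.succ
    have hmul := hasSum_mul_of_nonneg (hf 0) h (h0 0)
      fun ℓ => Finset.prod_nonneg fun j _ => h0 j.succ (ℓ j)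
    rw [← (Fin.consEquiv fun _ : Fin (m + 1) => ℕ).hasSum_iff, Fin.prod_univ_succ]
    refine hmul.congr_fun fun x => ?_
    simp only [Function.comp_apply, Fin.prod_univ_succ, Fin.consEquiv, Equiv.coe_fn_mk,
      Fin.cons_zero, Fin.cons_succ]

/-- Since `ℓ(ℓ+d) ≥ ℓ^2`, the terms are at most `ℓ^{-(2r-2d)}`, with exponent `2r - 2d > 2`. -/
theorem summable_cConst {d : ℕ} {r : ℝ} (hr : (d : ℝ) + 1 < r) : Summable fun i : ℕ =>
    ((i + 1 : ℕ) : ℝ) ^ (2 * d) / (((i + 1 : ℕ) : ℝ) * ((i + 1 : ℕ) + d)) ^ r := by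
  have hs : Summable fun i : ℕ => 1 / (i : ℝ) ^ (2 * r - 2 * d) :=
    Real.summable_one_div_nat_rpow.mpr (by linarith)
  refine Summable.of_nonneg_of_le (fun i => by positivity) (fun i => ?_)
    ((summable_nat_add_iff 1).mpr hs)
  have hx : (0 : ℝ) < ((i + 1 : ℕ) : ℝ) := by positivity
  set x : ℝ := ((i + 1 : ℕ) : ℝ)
  have hd : (0 : ℝ) ≤ d := by positivity
  rw [Real.rpow_sub hx, one_div_div, Real.rpow_mul hx.le 2 r]
  have h2 : x ^ (2 * (d : ℝ)) = x ^ (2 * d) := by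
    rw [← Real.rpow_natCast]; push_cast; rfl
  rw [h2, Real.rpow_two]
  have : (x ^ 2) ^ r ≤ (x * (x + d)) ^ r :=
    Real.rpow_le_rpow (by positivity) (by nlinarith) (by linarith)
  gcongr

/-- The bound for `P_ℓ(x, x) / B_{d,r,γ}(ℓ)`. -/
noncomputable def kernelBound (d : ℕ) (r M γ : ℝ) (ℓ : ℕ) : ℝ :=
  if ℓ = 0 then 1 else γ * (M * ((ℓ : ℝ) ^ (2 * d) / ((ℓ : ℝ) * (ℓ + d)) ^ r))

theorem hasSum_kernelBound {d : ℕ} {r : ℝ} (hr : (d : ℝ) + 1 < r) (M γ : ℝ) :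
    HasSum (kernelBound d r M γ) (1 + γ * cConst d r M) := by
  have h := (((summable_cConst hr).hasSum.mul_left M).mul_left γ)
  -- `cConst` is indexed by `ℓ - 1`; undoing the shift adds the term at `ℓ = 0`, which is 1.
  have h2 := (hasSum_nat_add_iff (f := kernelBound d r M γ) (g := γ * cConst d r M) 1).mp
    (by simpa [kernelBound, cConst] using h)
  simpa [kernelBound, add_comm] using h2

theorem B_pos {d : ℕ} (r : ℝ) {γ : ℝ} (hγ : 0 < γ) (ℓ : ℕ) : 0 < B d r γ ℓ := by
  unfold B
  split_ifs with h
  · exact one_pos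
  · have : (0 : ℝ) < ℓ := by exact_mod_cast Nat.pos_of_ne_zero h
    positivity

theorem simplex_nonempty (d : ℕ) : Nonempty (simplex d) := ⟨⟨0, by simp [simplex]⟩⟩

theorem IsKernelBound.nonneg {d : ℕ} {M : ℝ} (hM : IsKernelBound d M) : 0 ≤ M := by
  obtain ⟨x⟩ := simplex_nonempty d
  simpa using (kernelP_self_nonneg d 1 x).trans (hM 1 le_rfl x x)

theorem kernelBound_nonneg {d : ℕ} (r : ℝ) {M γ : ℝ} (hM : 0 ≤ M) (hγ : 0 < γ) (ℓ : ℕ) :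
    0 ≤ kernelBound d r M γ ℓ := by
  unfold kernelBound
  split_ifs <;> positivity

theorem kernelP_self_le_B_mul {d : ℕ} {r M γ : ℝ} (hM : IsKernelBound d M) (hγ : 0 < γ) (ℓ : ℕ)
    (x : simplex d) : kernelP d ℓ x x ≤ B d r γ ℓ * kernelBound d r M γ ℓ := by
  rcases eq_or_ne ℓ 0 with rfl | h
  · simpa [B, kernelBound] using kernelP_zero_self_le_one x
  · have hℓ : (0 : ℝ) < ℓ := by exact_mod_cast Nat.pos_of_ne_zero h
    have hpos : 0 < ((ℓ : ℝ) * (ℓ + d)) ^ r := by positivity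
    refine (hM ℓ (Nat.one_le_iff_ne_zero.mpr h) x x).trans_eq ?_
    simp only [B, kernelBound, if_neg h]
    field_simp

/-! ### Orthonormality and the continuous representative -/

theorem sum_prodP_sq {d m : ℕ} (ℓ : Fin m → ℕ) (x : Fin m → simplex d) :
    ∑ k, prodP ℓ k x ^ 2 = ∏ j, kernelP d (ℓ j) (x j) (x j) := by
  simp only [kernelP, Finset.prod_univ_sum, Fintype.piFinset_univ, prodP, prodPoly_apply, sq,
    Finset.prod_mul_distrib]

theorem variance_prodP_zero {d m : ℕ} (k : ∀ _ : Fin m, Fin (orthoDim d 0)) :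
    ProbabilityTheory.variance (prodP (fun _ => 0) k) (prodMeasure d m) = 0 := by
  have hc : ∀ j, ∃ c, P d 0 (k j) = MvPolynomial.C c := fun j =>
    ⟨_, MvPolynomial.totalDegree_eq_zero_iff_eq_C.mp
      (Nat.le_zero.mp (P_mem_orthoPoly d 0 (k j)).1)⟩
  choose c hc using hc
  have : (prodP (fun _ => 0) k : (Fin m → simplex d) → ℝ) = fun _ => ∏ j, c j := by
    ext x
    simp [prodP, prodPoly_apply, hc]
  rw [this]
  simp [ProbabilityTheory.variance_eq_integral]

theorem polyInner_P_of_lt {d ℓ ℓ' : ℕ} (h : ℓ < ℓ') (k : Fin (orthoDim d ℓ))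
    (k' : Fin (orthoDim d ℓ')) : polyInner d (P d ℓ k) (P d ℓ' k') = 0 := by
  rw [polyInner_comm]
  exact (P_mem_orthoPoly d ℓ' k').2 _ ((P_mem_orthoPoly d ℓ k).1.trans_lt h)

theorem polyInner_P_of_ne {d ℓ ℓ' : ℕ} (h : ℓ ≠ ℓ') (k : Fin (orthoDim d ℓ))
    (k' : Fin (orthoDim d ℓ')) : polyInner d (P d ℓ k) (P d ℓ' k') = 0 := by
  rcases h.lt_or_gt with h | h
  · exact polyInner_P_of_lt h k k'
  · rw [polyInner_comm]; exact polyInner_P_of_lt h k' k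

theorem integral_prodP_mul_prodP {d m : ℕ} (ℓ ℓ' : Fin m → ℕ) (k : ∀ j, Fin (orthoDim d (ℓ j)))
    (k' : ∀ j, Fin (orthoDim d (ℓ' j))) :
    ∫ x, prodP ℓ k x * prodP ℓ' k' x ∂prodMeasure d m =
      ∏ j, polyInner d (P d (ℓ j) (k j)) (P d (ℓ' j) (k' j)) := by
  simp only [prodP, prodPoly_apply, ← Finset.prod_mul_distrib, polyInner_apply]
  exact integral_fintype_prod_eq_prod fun j (y : simplex d) =>
    MvPolynomial.eval y.1 (P d (ℓ j) (k j)) * MvPolynomial.eval y.1 (P d (ℓ' j) (k' j))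

theorem integral_prodP_mul_prodP_of_ne {d m : ℕ} {ℓ ℓ' : Fin m → ℕ} (h : ℓ ≠ ℓ')
    (k : ∀ j, Fin (orthoDim d (ℓ j))) (k' : ∀ j, Fin (orthoDim d (ℓ' j))) :
    ∫ x, prodP ℓ k x * prodP ℓ' k' x ∂prodMeasure d m = 0 := by
  obtain ⟨j, hj⟩ := Function.ne_iff.mp h
  rw [integral_prodP_mul_prodP]
  exact Finset.prod_eq_zero (Finset.mem_univ j) (polyInner_P_of_ne hj _ _)

theorem integral_prodP_mul_prodP_self {d m : ℕ} (ℓ : Fin m → ℕ)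
    (k k' : ∀ j, Fin (orthoDim d (ℓ j))) :
    ∫ x, prodP ℓ k x * prodP ℓ k' x ∂prodMeasure d m = if k' = k then 1 else 0 := by
  rw [integral_prodP_mul_prodP]
  simp only [P_orthonormal, Finset.prod_ite_zero, Finset.mem_univ, true_imp_iff, funext_iff,
    Finset.prod_const_one, eq_comm]

/-- Integration against `prodP ℓ k` is continuous for the sup norm, so it passes through the series
term by term. -/
theorem integral_prodP_mul_sum_smul {d m : ℕ} {a : ∀ ℓ : Fin m → ℕ, (∀ j, Fin (orthoDim d (ℓ j))) → ℝ}
    (hs : Summable fun ℓ => ∑ k, a ℓ k • prodP ℓ k) (ℓ : Fin m → ℕ)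
    (k : ∀ j, Fin (orthoDim d (ℓ j))) :
    ∫ x, prodP ℓ k x * (∑' ℓ, ∑ k, a ℓ k • prodP ℓ k : C(Fin m → simplex d, ℝ)) x
      ∂prodMeasure d m = a ℓ k := by
  have hi : Integrable (prodP ℓ k) (prodMeasure d m) :=
    (memLp_continuousMap (prodP ℓ k) 1).integrable le_rfl
  rw [← integralMul_apply hi, (integralMul hi).map_tsum hs, tsum_eq_single ℓ]
  · simp only [map_sum, map_smul, integralMul_apply, integral_prodP_mul_prodP_self]
    simp
  · intro ℓ' hne
    simp only [map_sum, map_smul, integralMul_apply, integral_prodP_mul_prodP_of_ne hne.symm]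
    simp

/-- The sum of the series has the same coefficients as `u`, so completeness forces equality in `L₂`.
-/
theorem ae_eq_tsum_coeff {d m : ℕ} {u : Lp ℝ 2 (prodMeasure d m)}
    (hs : Summable fun ℓ : Fin m → ℕ => ∑ k, coeff ℓ k u • prodP ℓ k) :
    u =ᵐ[prodMeasure d m]
      (∑' ℓ : Fin m → ℕ, ∑ k, coeff ℓ k u • prodP ℓ k : C(Fin m → simplex d, ℝ)) := by
  set f : C(Fin m → simplex d, ℝ) := ∑' ℓ : Fin m → ℕ, ∑ k, coeff ℓ k u • prodP ℓ k with hf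
  set v := ContinuousMap.toLp 2 (prodMeasure d m) ℝ f with hv
  have hvf : v =ᵐ[prodMeasure d m] f := ContinuousMap.coeFn_toLp (prodMeasure d m) f
  have huv : u - v = 0 := by
    refine eq_zero_of_coeff_eq_zero fun ℓ k => ?_
    have h1 := integral_prodP_mul_sum_smul hs ℓ k
    rw [← hf] at h1
    have hi : ∀ w : Lp ℝ 2 (prodMeasure d m),
        Integrable (fun x => w x * prodP ℓ k x) (prodMeasure d m) := fun w =>
      (Lp.memLp w).integrable_mul (memLp_continuousMap (prodP ℓ k) 2)
    calc coeff ℓ k (u - v) = ∫ x, (u x * prodP ℓ k x - v x * prodP ℓ k x) ∂prodMeasure d m := by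
          refine integral_congr_ae ?_
          filter_upwards [Lp.coeFn_sub u v] with x hx
          rw [hx, Pi.sub_apply, sub_mul]
          rfl
      _ = coeff ℓ k u - ∫ x, prodP ℓ k x * f x ∂prodMeasure d m := by
          rw [integral_sub (hi u) (hi v)]
          congr 1
          refine integral_congr_ae ?_
          filter_upwards [hvf] with x hx
          rw [hx, mul_comm]
      _ = 0 := by rw [h1, sub_self]
  rw [sub_eq_zero.mp huv]
  exact hvf

/-! ### The worst-case error and the final estimate -/

/-- The error functional `I_m - Q_{n,m}` on continuous functions. -/
noncomputable def errorCLM {d m n : ℕ} (t : Fin n → Fin m → simplex d) :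
    C(Fin m → simplex d, ℝ) →L[ℝ] ℝ :=
  integralMul (integrable_const (1 : ℝ) : Integrable _ (prodMeasure d m)) -
    (1 / (n : ℝ)) • ∑ i, ContinuousMap.evalCLM ℝ (t i)

theorem errorCLM_apply {d m n : ℕ} (t : Fin n → Fin m → simplex d)
    (g : C(Fin m → simplex d, ℝ)) : errorCLM t g = I g - Q t g := by
  simp [errorCLM, integralMul_apply, I, Q]

theorem prodB_pos {d m : ℕ} (r : ℝ) {γ : Fin m → ℝ} (hγ : ∀ j, 0 < γ j) (ℓ : Fin m → ℕ) :
    0 < ∏ j, B d r (γ j) (ℓ j) :=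
  Finset.prod_pos fun j _ => B_pos r (hγ j) (ℓ j)

theorem sum_prodP_sq_le {d m : ℕ} {r M : ℝ} {γ : Fin m → ℝ} (hM : IsKernelBound d M)
    (hγ : ∀ j, 0 < γ j) (ℓ : Fin m → ℕ) (x : Fin m → simplex d) :
    ∑ k, prodP ℓ k x ^ 2 ≤
      (∏ j, B d r (γ j) (ℓ j)) * ∏ j, kernelBound d r M (γ j) (ℓ j) := by
  rw [sum_prodP_sq, ← Finset.prod_mul_distrib]
  exact Finset.prod_le_prod (fun j _ => kernelP_self_nonneg _ _ _)
    fun j _ => kernelP_self_le_B_mul hM (hγ j) (ℓ j) (x j)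

/-- The worst-case error is at most the dual norm of the error functional. -/
theorem worstCaseError_le {d m n : ℕ} {r M : ℝ} (hr : (d : ℝ) + 1 < r) (hM : IsKernelBound d M)
    {γ : Fin m → ℝ} (hγ : ∀ j, 0 < γ j) {t : Fin n → Fin m → simplex d} {R : ℝ}
    (hR : ∑' ℓ : Fin m → ℕ, ∑ k, ENNReal.ofReal
      ((I (prodP ℓ k) - Q t (prodP ℓ k)) ^ 2 / ∏ j, B d r (γ j) (ℓ j)) ≤ ENNReal.ofReal R) :
    worstCaseError r γ t ≤ ENNReal.ofReal (Real.sqrt R) := by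
  refine iSup_le fun u => iSup_le fun _ => iSup_le fun hu => ?_
  have hb0 : ∀ ℓ : Fin m → ℕ, 0 ≤ ∏ j, kernelBound d r M (γ j) (ℓ j) := fun ℓ =>
    Finset.prod_nonneg fun j _ => kernelBound_nonneg r hM.nonneg (hγ j) (ℓ j)
  have hb := hasSum_prod_pi (fun j => kernelBound_nonneg r hM.nonneg (hγ j))
    fun j => hasSum_kernelBound hr M (γ j)
  have hs : Summable fun ℓ : Fin m → ℕ => ∑ k, coeff ℓ k u • prodP ℓ k :=
    summable_sum_smul (prodB_pos r hγ) (sum_prodP_sq_le hM hγ) hb0 hb.summable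
      (summable_of_tsum_ofReal_ne_top
        (fun ℓ k => mul_nonneg (prodB_pos r hγ ℓ).le (sq_nonneg (coeff ℓ k u)))
        (ne_top_of_le_ne_top ENNReal.one_ne_top hu))
  -- The infimum over continuous representatives is bounded by its value at the Fourier series.
  refine iInf₂_le_of_le _ (ae_eq_tsum_coeff hs) ?_
  have h := ofReal_sq_map_tsum_le (prodB_pos r hγ) hs hu (errorCLM t)
  simp only [errorCLM_apply] at h
  have h' := h.trans hR
  rw [← Real.sqrt_sq_eq_abs]
  -- For `R < 0` both `ENNReal.ofReal R` and `Real.sqrt R` are 0, and the error vanishes.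
  rcases le_or_gt 0 R with h0 | h0
  · exact ENNReal.ofReal_le_ofReal (Real.sqrt_le_sqrt ((ENNReal.ofReal_le_ofReal_iff h0).mp h'))
  · rw [ENNReal.ofReal_of_nonpos h0.le, nonpos_iff_eq_zero, ENNReal.ofReal_eq_zero] at h'
    rw [Real.sqrt_eq_zero_of_nonpos h']
    simp

end SimplexQMC

theorem mainTheorem2 (d : ℕ) (hd : 1 ≤ d) :
    (∃ M : ℝ, SimplexQMC.IsKernelBound d M) ∧
    ∀ M : ℝ, SimplexQMC.IsKernelBound d M →
      ∀ r : ℝ, (d : ℝ) + 1 < r →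
      ∀ (m : ℕ) (γ : Fin m → ℝ), (∀ j, 0 < γ j) →
      ∀ n : ℕ, 1 ≤ n →
        ∃ t : Fin n → Fin m → SimplexQMC.simplex d,
          SimplexQMC.worstCaseError r γ t ^ 2 ≤
            ENNReal.ofReal
              (1 / (n : ℝ) * ((∏ j, (1 + γ j * SimplexQMC.cConst d r M)) - 1)) ∧
          SimplexQMC.worstCaseError r γ t ≤
            ENNReal.ofReal
              (Real.sqrt ((∏ j, (1 + γ j * SimplexQMC.cConst d r M)) - 1) *
                (n : ℝ) ^ (-(1 / 2) : ℝ)) := by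
  refine ⟨SimplexQMC.exists_isKernelBound d, fun M hM r hr m γ hγ n hn => ?_⟩
  have hb0 : ∀ ℓ : Fin m → ℕ, 0 ≤ ∏ j, SimplexQMC.kernelBound d r M (γ j) (ℓ j) := fun ℓ =>
    Finset.prod_nonneg fun j _ => SimplexQMC.kernelBound_nonneg r hM.nonneg (hγ j) (ℓ j)
  have hb := SimplexQMC.hasSum_prod_pi
    (fun j => SimplexQMC.kernelBound_nonneg r hM.nonneg (hγ j))
    fun j => SimplexQMC.hasSum_kernelBound hr M (γ j)
  have hone : ∏ j, SimplexQMC.kernelBound d r M (γ j) ((fun _ : Fin m => 0) j) = 1 := by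
    simp [SimplexQMC.kernelBound]
  set S : ℝ := ∏ j, (1 + γ j * SimplexQMC.cConst d r M) with hS
  -- `S` is a sum of nonnegative terms, one of which, at `ℓ = 0`, equals 1.
  have hS1 : 0 ≤ S - 1 := by
    rw [sub_nonneg, ← hone]
    exact le_hasSum hb _ fun ℓ _ => hb0 ℓ
  obtain ⟨t, ht⟩ := SimplexQMC.exists_points_tsum_sq_error_le
    (μ := SimplexQMC.prodMeasure d m) (SimplexQMC.prodB_pos r hγ)
    (SimplexQMC.sum_prodP_sq_le hM hγ) hb0 hb (fun _ => 0) SimplexQMC.variance_prodP_zero hn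
  rw [hone] at ht
  have herr := SimplexQMC.worstCaseError_le hr hM hγ ht
  refine ⟨t, ?_, herr.trans_eq ?_⟩
  · calc SimplexQMC.worstCaseError r γ t ^ 2
        ≤ ENNReal.ofReal (Real.sqrt (1 / (n : ℝ) * (S - 1))) ^ 2 := pow_le_pow_left' herr 2
      _ = ENNReal.ofReal (1 / (n : ℝ) * (S - 1)) := by
        rw [← ENNReal.ofReal_pow (Real.sqrt_nonneg _), Real.sq_sqrt (by positivity)]
  · congr 1
    rw [Real.sqrt_mul (by positivity), mul_comm, Real.rpow_neg (by positivity),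
      ← Real.sqrt_eq_rpow, one_div, Real.sqrt_inv]
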